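/- Let $k$ be a field, let $d\ge 0$ and $n>1$ be integers, and let $R=k[[x_1,\dots,x_d]]^{(n)}$ be the $n$-th Veronese subring of the formal power series ring $k[[x_1,\dots,x_d]]$, that is, the subring of all power series in which only monomials of total degree divisible by $n$ occur. Let $I$ and $J$ be elements of the divisor class group $\operatorname{Cl}(R)$, that is, finitely generated reflexive $R$-modules of rank one (an $R$-module $M$ is reflexive if the natural map $M\to M^{**}$, with $M^{*}=\operatorname{Hom}_R(M,R)$, is bijective). If $I\otimes_R J$ is reflexive, then $I\cong R$ or $J\cong R$ as $R$-modules. -/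

import Mathlib

open scoped TensorProduct

/-- The `n`-th Veronese subring `k[[x_1, …, x_d]]^(n)` of the formal power series ring
`k[[x_1, …, x_d]]`: the power series in which only monomials of total degree divisible by `n`
occur, i.e. the formal power series in the monomials of degree `n`. -/
def veroneseSubring (k : Type*) [Field k] (d n : ℕ) : Subalgebra k (MvPowerSeries (Fin d) k) where
  carrier := {f | ∀ m : Fin d →₀ ℕ, MvPowerSeries.coeff m f ≠ 0 → n ∣ m.degree}
  mul_mem' := by
    intro f g hf hg m hm
    rw [MvPowerSeries.coeff_mul] at hm
    obtain ⟨p, hp, hne⟩ := Finset.exists_ne_zero_of_sum_ne_zero hm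
    rw [← Finset.HasAntidiagonal.mem_antidiagonal.mp hp, map_add]
    exact dvd_add (hf _ (left_ne_zero_of_mul hne)) (hg _ (right_ne_zero_of_mul hne))
  add_mem' := by
    intro f g hf hg m hm
    by_cases h : MvPowerSeries.coeff m f = 0
    · exact hg m (by simpa [h] using hm)
    · exact hf m h
  algebraMap_mem' := by
    intro r m hm
    rw [MvPowerSeries.algebraMap_apply, MvPowerSeries.coeff_C] at hm
    by_cases h : m = 0
    · simp [h]
    · simp [h] at hm

instance (k : Type*) [Field k] (d n : ℕ) : IsDomain (veroneseSubring k d n) :=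
  haveI : IsDomain (MvPowerSeries (Fin d) k) := NoZeroDivisors.to_isDomain _
  inferInstance

/-- `M` represents an element of the divisor class group `Cl(R)` of the normal domain `R`:
it is a finitely generated reflexive `R`-module of rank one. (Over a domain, `Module.rank R M` is
the dimension of `M ⊗ Frac R` over `Frac R`.) -/
structure RepresentsDivisorClass (R : Type*) [CommRing R] [IsDomain R]
    (M : Type*) [AddCommGroup M] [Module R M] : Prop where
  finite : Module.Finite R M
  reflexive : Module.IsReflexive R M
  rank_eq_one : Module.rank R M = 1

/-! Write `S` for the power series ring and `S_j` for its part in degrees congruent to `j` modulo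
`n`, so that `R = S_0` and `S` is the direct sum of the `S_j`. Since `S` is factorial and local,
divisorial conditions given by elements of `R` have a homogeneous generator, so every reflexive
module of rank one, being the dual of a nonzero ideal, is isomorphic to some `S_j`
(`RepresentsDivisorClass.exists_equiv_veronesePiece`).

For `d ≤ 1` a nonzero `S_j` is free. For `d ≥ 2` and nonzero `i`, `j`, let `p + 1` and `q + 1` be
the representatives of `i`, `j` below `n`, and let `x`, `y` be two variables. Then `x^(p+1) ⊗ x^q y
- x^p y ⊗ x^(q+1)` in `S_i ⊗ S_j` is killed by `x^n`, but is nonzero after reduction to `k`.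
Reflexive modules are torsion-free, so `i = 0` or `j = 0`. -/

/-! ### Factoriality of formal power series rings. -/

/-- A monic divisor of a distinguished polynomial over a local ring is distinguished. -/
theorem Polynomial.IsDistinguishedAt.of_monic_dvd {A : Type*} [CommRing A] [IsLocalRing A]
    {p q : Polynomial A} (hp : p.IsDistinguishedAt (IsLocalRing.maximalIdeal A))
    (hq : q.Monic) (hqp : q ∣ p) : q.IsDistinguishedAt (IsLocalRing.maximalIdeal A) := by
  have h := Polynomial.map_dvd (IsLocalRing.residue A) hqp
  have h1 : p.map (IsLocalRing.residue A) = Polynomial.X ^ p.natDegree := hp.map_eq_X_pow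
  rw [h1, dvd_prime_pow Polynomial.prime_X] at h
  obtain ⟨i, -, hi⟩ := h
  have h2 : q.map (IsLocalRing.residue A) = Polynomial.X ^ i :=
    Polynomial.eq_of_monic_of_associated (hq.map _) (Polynomial.monic_X_pow i) hi
  have h3 : q.natDegree = i := by
    rw [← hq.natDegree_map (IsLocalRing.residue A), h2, Polynomial.natDegree_X_pow]
  refine ⟨⟨fun {n} hn => ?_⟩, hq⟩
  rw [← IsLocalRing.residue_eq_zero_iff, ← Polynomial.coeff_map, h2, Polynomial.coeff_X_pow,
    if_neg (by lia)]

/-- Over a complete local factorial domain, a prime ideal of `A⟦X⟧` containing a power series with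
nonzero reduction contains a prime element. -/
theorem PowerSeries.exists_prime_mem_of_map_residue_ne_zero {A : Type*} [CommRing A] [IsDomain A]
    [IsLocalRing A] [IsAdicComplete (IsLocalRing.maximalIdeal A) A] [UniqueFactorizationMonoid A]
    (Q : Ideal (PowerSeries A)) [hQ : Q.IsPrime] {g : PowerSeries A} (hgQ : g ∈ Q)
    (hg : g.map (IsLocalRing.residue A) ≠ 0) : ∃ q ∈ Q, Prime q := by
  obtain ⟨p, u, H⟩ := PowerSeries.exists_isWeierstrassFactorization hg
  have hp : p.IsDistinguishedAt (IsLocalRing.maximalIdeal A) := H.isDistinguishedAt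
  have hpQ : p ∈ Q.comap (Polynomial.coeToPowerSeries.ringHom (R := A)) := by
    have := H.eq_mul ▸ hgQ
    exact (hQ.mem_or_mem this).resolve_right
      fun hu => hQ.ne_top (Ideal.eq_top_of_isUnit_mem _ hu H.isUnit)
  obtain ⟨q, hqQ, hqp, hqprime⟩ : ∃ q ∈ Q.comap (Polynomial.coeToPowerSeries.ringHom (R := A)),
      q ∣ p ∧ Prime q := by
    obtain ⟨w, hw⟩ := UniqueFactorizationMonoid.factors_prod hp.monic.ne_zero
    have hmem : (UniqueFactorizationMonoid.factors p).prod ∈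
        Q.comap (Polynomial.coeToPowerSeries.ringHom (R := A)) := by
      rw [← hw] at hpQ
      exact ((Ideal.IsPrime.comap _).mem_or_mem hpQ).resolve_right fun hu =>
        (Ideal.IsPrime.comap (K := Q) (Polynomial.coeToPowerSeries.ringHom (R := A))).ne_top
          (Ideal.eq_top_of_isUnit_mem _ hu w.isUnit)
    obtain ⟨q, hq, hqQ⟩ := (Ideal.IsPrime.multiset_prod_mem_iff_exists_mem
      (Ideal.IsPrime.comap _) _).1 hmem
    exact ⟨q, hqQ, UniqueFactorizationMonoid.dvd_of_mem_factors hq,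
      UniqueFactorizationMonoid.prime_of_factor q hq⟩
  obtain ⟨r, hr⟩ := hqp
  have hlead : q.leadingCoeff * r.leadingCoeff = 1 := by
    rw [← Polynomial.leadingCoeff_mul, ← hr, hp.monic]
  -- `p` is monic, so the leading coefficient of its divisor `q` is a unit and `q` can be made
  -- monic.
  let v : Aˣ := ⟨r.leadingCoeff, q.leadingCoeff, by rw [mul_comm, hlead], hlead⟩
  let q' := q * Polynomial.C r.leadingCoeff
  have hq'm : q'.Monic := by
    simp [q', Polynomial.Monic, hlead]
  have hassoc : Associated q q' := ⟨Units.map Polynomial.C.toMonoidHom v, rfl⟩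
  have hq'p : Prime q' := hassoc.prime hqprime
  have hq'd : q'.IsDistinguishedAt (IsLocalRing.maximalIdeal A) :=
    hp.of_monic_dvd hq'm (hassoc.symm.dvd.trans ⟨r, hr⟩)
  refine ⟨(q' : PowerSeries A), ?_, ?_⟩
  · have : q' ∈ Q.comap (Polynomial.coeToPowerSeries.ringHom (R := A)) :=
      Ideal.mul_mem_right _ _ hqQ
    exact this
  · have hne : (q' : PowerSeries A) ≠ 0 := by
      simpa using hq'p.ne_zero
    -- By Weierstrass division, `A[X]/(q')` and `A⟦X⟧/(q')` are isomorphic, so primality passes to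
    -- power series.
    rw [← Ideal.span_singleton_prime hne, ← Ideal.Quotient.isDomain_iff_prime]
    have : IsDomain (Polynomial A ⧸ Ideal.span {q'}) := by
      rw [Ideal.Quotient.isDomain_iff_prime, Ideal.span_singleton_prime hq'p.ne_zero]
      exact hq'p
    exact hq'd.algEquivQuotient.symm.toMulEquiv.isDomain _

namespace MvPowerSeries

theorem mem_span_X_of_constantCoeff_eq_zero {k : Type*} [CommRing k] (d : ℕ)
    (f : MvPowerSeries (Fin d) k) (hf : constantCoeff f = 0) :
    f ∈ Ideal.span (Set.range (X : Fin d → MvPowerSeries (Fin d) k)) := by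
  induction d with
  | zero =>
    have : f = 0 := by
      ext m
      rw [Subsingleton.elim m 0]
      simpa using hf
    simp [this]
  | succ d ih =>
    let e := finSuccEquiv k d
    have key : e f = PowerSeries.C (PowerSeries.constantCoeff (e f)) +
        PowerSeries.X * PowerSeries.mk fun p => PowerSeries.coeff (p + 1) (e f) := by
      conv_lhs => rw [PowerSeries.eq_X_mul_shift_add_const (e f)]
      rw [add_comm]
    have h0 : constantCoeff (PowerSeries.constantCoeff (e f)) = 0 := by
      rw [← PowerSeries.coeff_zero_eq_constantCoeff_apply, ← coeff_zero_eq_constantCoeff_apply,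
        coeff_coeff_finSuccEquiv]
      simpa using hf
    have h1 := ih _ h0
    have h2 : e.toRingHom f ∈ (Ideal.span (Set.range
        (X : Fin (d + 1) → MvPowerSeries (Fin (d + 1)) k))).map
          e.toRingHom := by
      rw [Ideal.map_span]
      change e f ∈ _
      rw [key]
      refine Ideal.add_mem _ ?_ (Ideal.mul_mem_right _ _ (Ideal.subset_span ?_))
      · have h3 := Ideal.mem_map_of_mem (PowerSeries.C (R := MvPowerSeries (Fin d) k)) h1
        rw [Ideal.map_span] at h3
        refine Ideal.span_mono ?_ h3
        rintro _ ⟨_, ⟨i, rfl⟩, rfl⟩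
        exact ⟨X i.succ, ⟨i.succ, rfl⟩, finSuccEquiv_X_succ i⟩
      · exact ⟨X 0, ⟨0, rfl⟩, finSuccEquiv_X_zero⟩
    obtain ⟨y, hy, hye⟩ := (Ideal.mem_map_iff_of_surjective
      e.toRingHom e.surjective).1 h2
    rwa [← e.injective hye]

/-- Adic completeness is available for the ideal of the variables, while Weierstrass preparation
asks for it at the maximal ideal. -/
theorem span_range_X_eq_maximalIdeal (k : Type*) [Field k] (d : ℕ) :
    Ideal.span (Set.range (X : Fin d → MvPowerSeries (Fin d) k)) = IsLocalRing.maximalIdeal _ := by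
  refine le_antisymm (Ideal.span_le.2 ?_) fun f hf => mem_span_X_of_constantCoeff_eq_zero d f ?_
  · rintro _ ⟨i, rfl⟩
    simp [IsLocalRing.mem_maximalIdeal, mem_nonunits_iff, isUnit_iff_constantCoeff]
  · rw [IsLocalRing.mem_maximalIdeal, mem_nonunits_iff, isUnit_iff_constantCoeff] at hf
    simpa using hf

/-- Every nonempty set of exponents has a strictly lightest element for suitable positive
weights, the first of which is `1`. -/
theorem exists_weight_strict_min (d : ℕ) (A : Set (Fin d → ℕ)) (hA : A.Nonempty) :
    ∃ e : Fin d → ℕ, (∀ i, e i ≠ 0) ∧ (∀ i : Fin d, i.val = 0 → e i = 1) ∧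
      ∃ m ∈ A, ∀ m' ∈ A, m' ≠ m → ∑ i, m i * e i < ∑ i, m' i * e i := by
  classical
  induction d with
  | zero =>
    obtain ⟨m, hm⟩ := hA
    exact ⟨0, fun i => i.elim0, fun i => i.elim0, m, hm,
      fun m' _ h => (h (Subsingleton.elim _ _)).elim⟩
  | succ d ih =>
    have hex : ∃ c : ℕ, ∃ m : Fin d → ℕ, Fin.snoc (α := fun _ => ℕ) m c ∈ A := by
      obtain ⟨m, hm⟩ := hA
      exact ⟨m (Fin.last d), Fin.init m, by rwa [Fin.snoc_init_self]⟩
    let c := Nat.find hex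
    obtain ⟨e, he0, he1, m, hm, hmin⟩ := ih {m | Fin.snoc (α := fun _ => ℕ) m c ∈ A}
      (Nat.find_spec hex)
    -- `c` is the least last exponent. The last weight exceeds the weight of `m` in the other
    -- coordinates, so any larger last exponent is heavier; exponents with last entry `c` are
    -- compared by induction.
    refine ⟨Fin.snoc (α := fun _ => ℕ) e (∑ i, m i * e i + 1), fun i => ?_, fun i hi => ?_,
      Fin.snoc (α := fun _ => ℕ) m c, hm, fun m' hm' hne => ?_⟩
    · induction i using Fin.lastCases with
      | last => simp
      | cast i => simpa using he0 i
    · induction i using Fin.lastCases with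
      | last =>
        have hd : d = 0 := by simpa using hi
        subst hd
        rw [Fin.snoc_last]
        simp
      | cast i => simpa using he1 i (by simpa using hi)
    · obtain ⟨n, b, rfl⟩ : ∃ (n : Fin d → ℕ) (b : ℕ), m' = Fin.snoc (α := fun _ => ℕ) n b :=
        ⟨Fin.init m', m' (Fin.last d), by rw [Fin.snoc_init_self]⟩
      simp only [Fin.sum_univ_castSucc, Fin.snoc_castSucc, Fin.snoc_last]
      have hcb : c ≤ b := Nat.find_min' hex ⟨n, hm'⟩
      rcases hcb.eq_or_lt with rfl | hlt
      · have := hmin n hm' (fun h => hne (by rw [h]))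
        lia
      · have h := Nat.mul_le_mul_right (∑ i, m i * e i + 1) (Nat.succ_le_of_lt hlt)
        rw [Nat.succ_mul] at h
        lia

section Shear

variable (k : Type*) [Field k] {d : ℕ} (e : Fin (d + 1) → ℕ)

/-- The values of the variables under the substitution `X i ↦ X i + c * X 0 ^ e i` for `i ≠ 0`. -/
noncomputable def shear (c : k) (i : Fin (d + 1)) : MvPowerSeries (Fin (d + 1)) k :=
  if i = 0 then X 0 else X i + C c * X 0 ^ e i

variable {k e}

theorem hasSubst_shear (he : ∀ i, e i ≠ 0) (c : k) : HasSubst (shear k e c) := by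
  refine hasSubst_of_constantCoeff_zero fun i => ?_
  unfold shear
  split_ifs with h
  · simp
  · simp [he i]

theorem subst_shear_shear_neg (he : ∀ i, e i ≠ 0) (c : k) (i : Fin (d + 1)) :
    subst (shear k e c) (shear k e (-c) i) = X i := by
  have hs := hasSubst_shear he c
  rw [← coe_substAlgHom (R := k) hs]
  have hX (j) : substAlgHom (R := k) hs (X j) = shear k e c j := substAlgHom_X hs j
  have hC (r : k) : substAlgHom (R := k) hs (C r) = C r := (substAlgHom (R := k) hs).commutes r
  by_cases h : i = 0
  · subst h
    simp [shear, hX]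
  · have hi : shear k e (-c) i = X i + C (-c) * X 0 ^ e i := if_neg h
    rw [hi, map_add, map_mul, map_pow, hX, hX, hC]
    simp [shear, h]

/-- The automorphism `X i ↦ X i + X 0 ^ e i` for `i ≠ 0`. -/
noncomputable def shearEquiv (he : ∀ i, e i ≠ 0) :
    MvPowerSeries (Fin (d + 1)) k ≃ₐ[k] MvPowerSeries (Fin (d + 1)) k :=
  AlgEquiv.ofAlgHom (substAlgHom (hasSubst_shear he 1)) (substAlgHom (hasSubst_shear he (-1)))
    (by
      ext1 f
      rw [AlgHom.comp_apply]
      rw [coe_substAlgHom, coe_substAlgHom, subst_comp_subst_apply (hasSubst_shear he _)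
        (hasSubst_shear he _), funext (subst_shear_shear_neg he 1)]
      exact congrFun (subst_self (R := k)) f)
    (by
      ext1 f
      rw [AlgHom.comp_apply]
      have h := funext (subst_shear_shear_neg he (-1 : k))
      rw [neg_neg] at h
      rw [coe_substAlgHom, coe_substAlgHom, subst_comp_subst_apply (hasSubst_shear he _)
        (hasSubst_shear he _), h]
      exact congrFun (subst_self (R := k)) f)

/-- Setting all variables except the first to `0`. -/
noncomputable def toFirstVariable (k : Type*) [Field k] (d : ℕ) :
    MvPowerSeries (Fin (d + 1)) k →+* PowerSeries k :=
  (PowerSeries.map constantCoeff).comp (finSuccEquiv k d).toRingHom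

theorem coeff_toFirstVariable (f : MvPowerSeries (Fin (d + 1)) k) (n : ℕ) :
    PowerSeries.coeff n (toFirstVariable k d f) = coeff (Finsupp.cons n 0) f := by
  rw [← coeff_coeff_finSuccEquiv, coeff_zero_eq_constantCoeff_apply]
  exact PowerSeries.coeff_map constantCoeff n _

theorem toFirstVariable_shear (he : e 0 = 1) (i : Fin (d + 1)) :
    toFirstVariable k d (shear k e 1 i) = PowerSeries.X ^ e i := by
  have h0 : toFirstVariable k d (X 0) = PowerSeries.X := by
    simp [toFirstVariable]
  induction i using Fin.cases with
  | zero => simp [shear, h0, he]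
  | succ i =>
    have h1 : toFirstVariable k d (X i.succ) = 0 := by
      simp [toFirstVariable]
    simp [shear, h0, h1]

/-- After the shear, killing all variables but the first turns the monomial `p` into a power of `X`
whose exponent is its weight. The strictly lightest monomial of `f` therefore keeps its coefficient,
with nothing to cancel it. -/
theorem exists_shear_coeff_ne_zero {f : MvPowerSeries (Fin (d + 1)) k} (hf : f ≠ 0) :
    ∃ (e : Fin (d + 1) → ℕ) (he : ∀ i, e i ≠ 0),
      toFirstVariable k d (shearEquiv (k := k) he f) ≠ 0 := by
  obtain ⟨m₀, hm₀⟩ := (ne_zero_iff_exists_coeff_ne_zero f).1 hf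
  obtain ⟨e, he, he1, m, hm, hmin⟩ := exists_weight_strict_min (d + 1)
    ((fun m : Fin (d + 1) →₀ ℕ => (m : Fin (d + 1) → ℕ)) '' {m | coeff m f ≠ 0}) ⟨_, m₀, hm₀, rfl⟩
  obtain ⟨m, hm, rfl⟩ := hm
  have hm : coeff m f ≠ 0 := hm
  refine ⟨e, he, fun h => hm ?_⟩
  have hterm (p : Fin (d + 1) →₀ ℕ) (n : ℕ) :
      coeff (Finsupp.cons n 0) (p.prod fun s t => shear k e 1 s ^ t) =
        if n = ∑ i, p i * e i then 1 else 0 := by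
    rw [← coeff_toFirstVariable, Finsupp.prod_fintype _ _ (by simp), map_prod]
    simp_rw [map_pow, toFirstVariable_shear (he1 0 rfl), ← pow_mul]
    rw [Finset.prod_pow_eq_pow_sum, PowerSeries.coeff_X_pow]
    simp_rw [mul_comm]
  have h1 : coeff (Finsupp.cons (∑ i, m i * e i) 0) (subst (shear k e 1) f) = 0 := by
    rw [← coeff_toFirstVariable]
    have : subst (shear k e 1) f = shearEquiv (k := k) he f :=
      (substAlgHom_apply (hasSubst_shear he 1) f).symm
    rw [this, h, map_zero]
  rw [coeff_subst (hasSubst_shear he 1), finsum_eq_single _ m] at h1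
  · simpa only [hterm, if_true, smul_eq_mul, mul_one] using h1
  · intro p hp
    by_cases hpf : coeff p f = 0
    · simp [hpf]
    · have := hmin p ⟨p, hpf, rfl⟩ (fun h => hp (DFunLike.coe_injective h))
      rw [hterm, if_neg this.ne, smul_zero]

end Shear

/-- Induction on `d` with Kaplansky's criterion: every nonzero prime ideal must contain a prime
element. A shear makes some element of the ideal regular in the first variable, and Weierstrass
preparation applies. -/
theorem uniqueFactorizationMonoid (k : Type*) [Field k] (d : ℕ) :
    UniqueFactorizationMonoid (MvPowerSeries (Fin d) k) := by
  have (d : ℕ) : IsDomain (MvPowerSeries (Fin d) k) := NoZeroDivisors.to_isDomain _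
  induction d with
  | zero =>
    exact (isEmptyEquiv (Fin 0) k).symm.toMulEquiv.uniqueFactorizationMonoid inferInstance
  | succ d ih =>
    rw [UniqueFactorizationMonoid.iff_exists_prime_mem_of_isPrime]
    intro P hP hPprime
    obtain ⟨f, hfP, hf⟩ := Submodule.exists_mem_ne_zero_of_ne_bot hP
    obtain ⟨e, he, hfe⟩ := exists_shear_coeff_ne_zero hf
    let φ := (shearEquiv (k := k) he).trans (finSuccEquiv k d)
    have : IsAdicComplete (IsLocalRing.maximalIdeal (MvPowerSeries (Fin d) k))
        (MvPowerSeries (Fin d) k) := by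
      rw [← span_range_X_eq_maximalIdeal]
      infer_instance
    have hmem : φ f ∈ P.comap φ.symm.toRingHom := by
      change φ.symm (φ f) ∈ P
      rwa [φ.symm_apply_apply]
    have hne : (φ f).map (IsLocalRing.residue _) ≠ 0 := by
      intro h
      apply hfe
      ext n
      have h1 := congrArg (PowerSeries.coeff n) h
      rw [PowerSeries.coeff_map, map_zero, IsLocalRing.residue_eq_zero_iff,
        IsLocalRing.mem_maximalIdeal, mem_nonunits_iff, isUnit_iff_constantCoeff] at h1
      exact not_not.1 fun h2 => h1 (isUnit_iff_ne_zero.2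
        (by simpa [toFirstVariable, φ] using h2))
    obtain ⟨q, hq, hqp⟩ := PowerSeries.exists_prime_mem_of_map_residue_ne_zero
      (P.comap φ.symm.toRingHom) hmem hne
    exact ⟨φ.symm q, hq, (MulEquiv.prime_iff φ.symm.toMulEquiv).2 hqp⟩

end MvPowerSeries

/-! ### The grading modulo `n`. -/

section Pieces

variable (k : Type*) [Field k] (d n : ℕ)

/-- The power series all of whose monomials have degree congruent to `j` modulo `n`. -/
def veronesePiece (j : ZMod n) :
    Submodule (veroneseSubring k d n) (MvPowerSeries (Fin d) k) where
  carrier := {f | ∀ m : Fin d →₀ ℕ, MvPowerSeries.coeff m f ≠ 0 → (m.degree : ZMod n) = j}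
  add_mem' {f g} hf hg m hm := by
    by_cases h : MvPowerSeries.coeff m f = 0
    · exact hg m (by simpa [h] using hm)
    · exact hf m h
  zero_mem' m hm := by simp at hm
  smul_mem' r f hf m hm := by
    change MvPowerSeries.coeff m ((r : MvPowerSeries (Fin d) k) * f) ≠ 0 at hm
    rw [MvPowerSeries.coeff_mul] at hm
    obtain ⟨p, hp, hne⟩ := Finset.exists_ne_zero_of_sum_ne_zero hm
    rw [← Finset.HasAntidiagonal.mem_antidiagonal.mp hp, map_add, Nat.cast_add,
      hf _ (right_ne_zero_of_mul hne),
      (ZMod.natCast_eq_zero_iff _ _).2 (r.2 _ (left_ne_zero_of_mul hne)), zero_add]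

variable {k d n}

theorem mem_veronesePiece_zero {f : MvPowerSeries (Fin d) k} :
    f ∈ veronesePiece k d n 0 ↔ f ∈ veroneseSubring k d n :=
  forall₂_congr fun _ _ => ZMod.natCast_eq_zero_iff _ _

theorem mul_mem_veronesePiece {i j : ZMod n} {f g : MvPowerSeries (Fin d) k}
    (hf : f ∈ veronesePiece k d n i) (hg : g ∈ veronesePiece k d n j) :
    f * g ∈ veronesePiece k d n (i + j) := by
  intro m hm
  rw [MvPowerSeries.coeff_mul] at hm
  obtain ⟨p, hp, hne⟩ := Finset.exists_ne_zero_of_sum_ne_zero hm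
  rw [← Finset.HasAntidiagonal.mem_antidiagonal.mp hp, map_add, Nat.cast_add,
    hf _ (left_ne_zero_of_mul hne), hg _ (right_ne_zero_of_mul hne)]

/-- The part of a power series in degrees congruent to `j` modulo `n`. -/
noncomputable def degreePart (j : ZMod n) (f : MvPowerSeries (Fin d) k) : MvPowerSeries (Fin d) k :=
  fun m => if (m.degree : ZMod n) = j then MvPowerSeries.coeff m f else 0

theorem coeff_degreePart (j : ZMod n) (f : MvPowerSeries (Fin d) k) (m : Fin d →₀ ℕ) :
    MvPowerSeries.coeff m (degreePart j f) =
      if (m.degree : ZMod n) = j then MvPowerSeries.coeff m f else 0 := rfl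

theorem degreePart_mem (j : ZMod n) (f : MvPowerSeries (Fin d) k) :
    degreePart j f ∈ veronesePiece k d n j := by
  intro m hm
  rw [coeff_degreePart] at hm
  by_contra h
  exact hm (if_neg h)

theorem degreePart_of_mem {j : ZMod n} {f : MvPowerSeries (Fin d) k}
    (hf : f ∈ veronesePiece k d n j) : degreePart j f = f := by
  ext m
  rw [coeff_degreePart]
  split_ifs with h
  · rfl
  · by_contra h'
    exact h (hf m (Ne.symm h'))

theorem degreePart_mul {i : ZMod n} {a : MvPowerSeries (Fin d) k}
    (ha : a ∈ veronesePiece k d n i) (j : ZMod n) (f : MvPowerSeries (Fin d) k) :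
    degreePart (i + j) (a * f) = a * degreePart j f := by
  ext m
  rw [coeff_degreePart, MvPowerSeries.coeff_mul, MvPowerSeries.coeff_mul]
  split_ifs with h
  · refine Finset.sum_congr rfl fun p hp => ?_
    by_cases h1 : MvPowerSeries.coeff p.1 a = 0
    · simp [h1]
    · rw [coeff_degreePart, if_pos]
      rw [← Finset.HasAntidiagonal.mem_antidiagonal.mp hp, map_add, Nat.cast_add, ha _ h1] at h
      exact add_left_cancel h
  · refine (Finset.sum_eq_zero fun p hp => ?_).symm
    by_cases h1 : MvPowerSeries.coeff p.1 a = 0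
    · simp [h1]
    · rw [coeff_degreePart, if_neg, mul_zero]
      intro h2
      apply h
      rw [← Finset.HasAntidiagonal.mem_antidiagonal.mp hp, map_add, Nat.cast_add, ha _ h1, h2]

theorem sum_degreePart [NeZero n] (f : MvPowerSeries (Fin d) k) :
    ∑ j : ZMod n, degreePart j f = f := by
  ext m
  rw [map_sum]
  simp [coeff_degreePart]

theorem mem_veronesePiece_of_mul_mem {i j : ZMod n} {a f : MvPowerSeries (Fin d) k}
    (ha : a ∈ veronesePiece k d n i) (ha0 : a ≠ 0) (haf : a * f ∈ veronesePiece k d n j) :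
    f ∈ veronesePiece k d n (j - i) := by
  have h := degreePart_mul ha (j - i) f
  rw [add_sub_cancel, degreePart_of_mem haf] at h
  rw [mul_left_cancel₀ ha0 h]
  exact degreePart_mem _ _

end Pieces

/-! ### Duals of ideals of the Veronese ring. -/

/-- In a factorial domain, the elements `z` such that `a` divides `z * b` for all `b` in a given
set form a principal ideal. -/
theorem UniqueFactorizationMonoid.exists_generator_dvd_mul {S : Type*} [CommRing S] [IsDomain S]
    [UniqueFactorizationMonoid S] {a : S} (ha : a ≠ 0) (B : Set S) :
    ∃ g : S, g ≠ 0 ∧ ∀ z, (∀ b ∈ B, a ∣ z * b) ↔ g ∣ z := by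
  classical
  let _ := UniqueFactorizationMonoid.toGCDMonoid S
  -- The set is closed under gcds, so an element minimal for strict divisibility divides all the
  -- others.
  obtain ⟨g, ⟨hg0, hg⟩, hmin⟩ := (IsWellFounded.wf (r := (DvdNotUnit : S → S → Prop))).has_min
    {z | z ≠ 0 ∧ ∀ b ∈ B, a ∣ z * b} ⟨a, ha, fun b _ => dvd_mul_right a b⟩
  refine ⟨g, hg0, fun z => ⟨fun hz => ?_, fun ⟨c, hc⟩ b hb => ?_⟩⟩
  · have hmem : gcd g z ≠ 0 ∧ ∀ b ∈ B, a ∣ gcd g z * b :=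
      ⟨fun h => hg0 ((gcd_eq_zero_iff _ _).1 h).1, fun b hb =>
        (dvd_gcd (hg b hb) (hz b hb)).trans (gcd_mul_right' b g z).dvd⟩
    have h1 := hmin _ hmem
    have h2 : g ∣ gcd g z := by
      by_contra h
      exact h1 (dvdNotUnit_of_dvd_of_not_dvd (gcd_dvd_left g z) h)
    exact h2.trans (gcd_dvd_right g z)
  · rw [hc, mul_right_comm]
    exact (hg b hb).mul_right c

section DualIdeal

variable {k : Type*} [Field k] {d n : ℕ}

/-- As `a` and `B` have degree `0` modulo `n`, each degree part of a generator `g` satisfies the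
same condition, hence equals `g * h j`. The `h j` sum to `1`, so one of them is a unit and that part
is a generator too. -/
theorem exists_homogeneous_generator_dvd_mul [NeZero n] {a : MvPowerSeries (Fin d) k}
    (ha : a ∈ veroneseSubring k d n) (ha0 : a ≠ 0) (B : Set (MvPowerSeries (Fin d) k))
    (hB : ∀ b ∈ B, b ∈ veroneseSubring k d n) :
    ∃ (j : ZMod n) (g : MvPowerSeries (Fin d) k), g ∈ veronesePiece k d n j ∧ g ≠ 0 ∧
      ∀ z, (∀ b ∈ B, a ∣ z * b) ↔ g ∣ z := by
  have : IsDomain (MvPowerSeries (Fin d) k) := NoZeroDivisors.to_isDomain _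
  have := MvPowerSeries.uniqueFactorizationMonoid k d
  obtain ⟨g, hg0, hg⟩ := UniqueFactorizationMonoid.exists_generator_dvd_mul ha0 B
  have hpart (j : ZMod n) : g ∣ degreePart j g := by
    rw [← hg]
    intro b hb
    obtain ⟨s, hs⟩ := (hg g).2 dvd_rfl b hb
    refine ⟨degreePart j s, ?_⟩
    rw [mul_comm, ← degreePart_mul (mem_veronesePiece_zero.2 (hB b hb)), mul_comm b, hs,
      degreePart_mul (mem_veronesePiece_zero.2 ha)]
  choose h hh using hpart
  have hsum : ∑ j, h j = 1 := by
    apply mul_left_cancel₀ hg0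
    rw [Finset.mul_sum, mul_one]
    simp_rw [← hh]
    exact sum_degreePart g
  obtain ⟨j, hj⟩ : ∃ j, MvPowerSeries.constantCoeff (h j) ≠ 0 := by
    by_contra! hc
    have := congrArg MvPowerSeries.constantCoeff hsum
    simp [map_sum, hc] at this
  have hu : IsUnit (h j) := MvPowerSeries.isUnit_iff_constantCoeff.2 (isUnit_iff_ne_zero.2 hj)
  have hass : Associated g (degreePart j g) := ⟨hu.unit, (hh j).symm⟩
  exact ⟨j, degreePart j g, degreePart_mem j g, hass.ne_zero_iff.1 hg0,
    fun z => (hg z).trans hass.dvd_iff_dvd_left⟩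

/-- The dual of a nonzero ideal of the Veronese ring is one of the pieces. -/
theorem exists_dual_ideal_equiv_veronesePiece [NeZero n] (A : Ideal (veroneseSubring k d n))
    (hA : A ≠ ⊥) :
    ∃ j : ZMod n, Nonempty (Module.Dual (veroneseSubring k d n) A ≃ₗ[veroneseSubring k d n]
      veronesePiece k d n j) := by
  obtain ⟨a, haA, ha0⟩ := Submodule.exists_mem_ne_zero_of_ne_bot hA
  have ha0' : (a : MvPowerSeries (Fin d) k) ≠ 0 := fun h => ha0 (Subtype.ext h)
  obtain ⟨j, g, hgj, hg0, hg⟩ := exists_homogeneous_generator_dvd_mul a.2 ha0'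
    ((fun r : veroneseSubring k d n => (r : MvPowerSeries (Fin d) k)) '' A)
    (by rintro _ ⟨b, -, rfl⟩; exact b.2)
  -- Evaluation at `a` identifies the dual with the `z` in `R` such that `z * b` lies in `a R` for
  -- all `b` in `A`. These are the multiples of `g` lying in `R`, that is `g` times the piece of
  -- degree `-j`.
  let α : veronesePiece k d n (0 - j) →ₗ[veroneseSubring k d n] MvPowerSeries (Fin d) k :=
    (LinearMap.mulLeft (veroneseSubring k d n) g).comp (veronesePiece k d n (0 - j)).subtype
  let β : Module.Dual (veroneseSubring k d n) A →ₗ[veroneseSubring k d n]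
      MvPowerSeries (Fin d) k :=
    (Algebra.linearMap (veroneseSubring k d n) (MvPowerSeries (Fin d) k)).comp
      (LinearMap.applyₗ (⟨a, haA⟩ : A))
  have hβ (φ) : β φ = (φ ⟨a, haA⟩ : veroneseSubring k d n) := rfl
  have hcomm (φ : Module.Dual (veroneseSubring k d n) A) (b : A) :
      φ ⟨a, haA⟩ * (b : veroneseSubring k d n) = a * φ b := by
    have h1 : (b : veroneseSubring k d n) • (⟨a, haA⟩ : A) = a • b :=
      Subtype.ext (mul_comm (b : veroneseSubring k d n) a)
    have h2 := congrArg φ h1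
    rw [map_smul, map_smul] at h2
    rw [mul_comm]
    exact h2
  have hα_inj : Function.Injective α := by
    intro x y hxy
    exact Subtype.ext (mul_left_cancel₀ hg0 hxy)
  have hβ_inj : Function.Injective β := by
    intro φ ψ h
    ext1 b
    have h' : φ ⟨a, haA⟩ = ψ ⟨a, haA⟩ := Subtype.ext h
    apply mul_left_cancel₀ ha0
    rw [← hcomm, ← hcomm, h']
  have hrange : LinearMap.range β = LinearMap.range α := by
    ext z
    constructor
    · rintro ⟨φ, rfl⟩
      obtain ⟨s, hs⟩ : g ∣ β φ := by
        rw [← hg]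
        rintro _ ⟨b, hb, rfl⟩
        exact ⟨φ ⟨b, hb⟩, congrArg Subtype.val (hcomm φ ⟨b, hb⟩)⟩
      refine ⟨⟨s, ?_⟩, hs.symm⟩
      refine mem_veronesePiece_of_mul_mem hgj hg0 ?_
      rw [← hs]
      exact mem_veronesePiece_zero.2 (φ ⟨a, haA⟩).2
    · rintro ⟨s, rfl⟩
      have hz : g * s ∈ veroneseSubring k d n := by
        have := mul_mem_veronesePiece hgj s.2
        rwa [add_sub_cancel, mem_veronesePiece_zero] at this
      have hdvd (b : A) : ∃ t : veroneseSubring k d n, (⟨g * s, hz⟩ : veroneseSubring k d n) * b =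
          a * t := by
        obtain ⟨t, ht⟩ := (hg (g * s)).2 (dvd_mul_right _ _) _ ⟨b, b.2, rfl⟩
        refine ⟨⟨t, ?_⟩, Subtype.ext ht⟩
        rw [← mem_veronesePiece_zero, ← sub_zero (0 : ZMod n)]
        refine mem_veronesePiece_of_mul_mem (mem_veronesePiece_zero.2 a.2) ha0' ?_
        rw [← ht, mem_veronesePiece_zero]
        exact mul_mem hz (b : veroneseSubring k d n).2
      choose t ht using hdvd
      refine ⟨{ toFun := t, map_add' := fun b c => ?_, map_smul' := fun r b => ?_ }, ?_⟩
      · apply mul_left_cancel₀ ha0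
        rw [mul_add, ← ht, ← ht, ← ht, Submodule.coe_add, mul_add]
      · apply mul_left_cancel₀ ha0
        rw [← ht, RingHom.id_apply, smul_eq_mul, mul_left_comm, ← ht, Submodule.coe_smul,
          smul_eq_mul, mul_left_comm]
      · rw [hβ]
        refine congrArg Subtype.val (?_ : t ⟨a, haA⟩ = ⟨g * s, hz⟩)
        apply mul_left_cancel₀ ha0
        rw [← ht, mul_comm]
  exact ⟨0 - j, ⟨(LinearEquiv.ofInjective β hβ_inj).trans
    ((LinearEquiv.ofEq _ _ hrange).trans (LinearEquiv.ofInjective α hα_inj).symm)⟩⟩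

end DualIdeal

/-! ### Reflexive modules of rank one as duals of ideals. -/

section RankOne

variable {R : Type*} [CommRing R] [IsDomain R] {M : Type*} [AddCommGroup M] [Module R M]

theorem Module.IsReflexive.smul_eq_zero [Module.IsReflexive R M] {r : R} {x : M} (hr : r ≠ 0)
    (h : r • x = 0) : x = 0 := by
  apply (Module.bijective_dual_eval R M).injective
  ext φ
  have : r * φ x = 0 := by rw [← smul_eq_mul, ← map_smul, h, map_zero]
  simpa [hr] using this

/-- A reflexive module of rank one is isomorphic to the dual of a nonzero ideal. -/
theorem Module.IsReflexive.exists_equiv_dual_ideal [Module.IsReflexive R M]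
    (hM : Module.rank R M = 1) :
    ∃ A : Ideal R, A ≠ ⊥ ∧ Nonempty (M ≃ₗ[R] Module.Dual R A) := by
  have : Nontrivial M := by
    by_contra h
    rw [not_nontrivial_iff_subsingleton] at h
    rw [rank_subsingleton'] at hM
    exact zero_ne_one hM
  obtain ⟨a, ha⟩ := exists_ne (0 : M)
  -- Rank one makes every `x` dependent on `a`, so a functional is determined by its value at `a`.
  -- This embeds the dual as an ideal; dualizing once more recovers `M`.
  let ev : Module.Dual R M →ₗ[R] R := LinearMap.applyₗ a
  have hev : Function.Injective ev := by
    rw [injective_iff_map_eq_zero]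
    intro φ hφ
    have hφ : φ a = 0 := hφ
    ext x
    have hdep : ¬ LinearIndependent R ![a, x] := by
      intro hli
      have := hli.cardinal_lift_le_rank
      rw [hM] at this
      simp at this
    rw [LinearIndependent.pair_iff] at hdep
    push Not at hdep
    obtain ⟨s, t, hst, hne⟩ := hdep
    have ht : t ≠ 0 := by
      rintro rfl
      rw [zero_smul, add_zero] at hst
      exact hne (by_contra fun hs => ha (Module.IsReflexive.smul_eq_zero hs hst)) rfl
    have := congrArg φ hst
    simpa [hφ, ht] using this
  refine ⟨LinearMap.range ev, fun hbot => ?_, ⟨(Module.evalEquiv R M).trans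
    (LinearEquiv.ofInjective ev hev).symm.dualMap⟩⟩
  apply ha
  apply (Module.bijective_dual_eval R M).injective
  ext φ
  have : ev φ ∈ (⊥ : Ideal R) := hbot ▸ LinearMap.mem_range_self ev φ
  rw [map_zero]
  exact this

end RankOne

theorem RepresentsDivisorClass.exists_equiv_veronesePiece {k : Type*} [Field k] {d n : ℕ}
    [NeZero n] {I : Type*} [AddCommGroup I] [Module (veroneseSubring k d n) I]
    (hI : RepresentsDivisorClass (veroneseSubring k d n) I) :
    ∃ j : ZMod n, Nonempty (I ≃ₗ[veroneseSubring k d n] veronesePiece k d n j) := by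
  have := hI.reflexive
  obtain ⟨A, hA, ⟨e⟩⟩ := Module.IsReflexive.exists_equiv_dual_ideal hI.rank_eq_one
  obtain ⟨j, ⟨e'⟩⟩ := exists_dual_ideal_equiv_veronesePiece A hA
  exact ⟨j, ⟨e.trans e'⟩⟩

/-! ### Free pieces. -/

section Free

variable {k : Type*} [Field k] {d n : ℕ}

theorem nonempty_veronesePiece_equiv_of_forall_dvd {j : ZMod n} {g : MvPowerSeries (Fin d) k}
    (hg : g ∈ veronesePiece k d n j) (hg0 : g ≠ 0) (h : ∀ f ∈ veronesePiece k d n j, g ∣ f) :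
    Nonempty (veronesePiece k d n j ≃ₗ[veroneseSubring k d n] veroneseSubring k d n) := by
  refine ⟨(LinearEquiv.ofBijective
    (LinearMap.toSpanSingleton (veroneseSubring k d n) (veronesePiece k d n j) ⟨g, hg⟩)
    ⟨fun r s hrs => ?_, fun f => ?_⟩).symm⟩
  · exact Subtype.ext (mul_right_cancel₀ hg0 (congrArg Subtype.val hrs))
  · obtain ⟨s, hs⟩ := h f f.2
    have hs' : s ∈ veroneseSubring k d n := by
      rw [← mem_veronesePiece_zero, ← sub_self j]
      exact mem_veronesePiece_of_mul_mem hg hg0 (hs ▸ f.2)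
    exact ⟨⟨s, hs'⟩, Subtype.ext ((mul_comm _ _).trans hs.symm)⟩

theorem nonempty_veronesePiece_zero_equiv :
    Nonempty (veronesePiece k d n 0 ≃ₗ[veroneseSubring k d n] veroneseSubring k d n) :=
  nonempty_veronesePiece_equiv_of_forall_dvd (g := 1) (mem_veronesePiece_zero.2 (one_mem _))
    one_ne_zero fun f _ => one_dvd f

/-- In at most one variable, every nonzero piece is free. -/
theorem nonempty_veronesePiece_equiv_of_le_one [NeZero n] (hd : d ≤ 1) {j : ZMod n}
    (hj : veronesePiece k d n j ≠ ⊥) :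
    Nonempty (veronesePiece k d n j ≃ₗ[veroneseSubring k d n] veroneseSubring k d n) := by
  obtain rfl | rfl : d = 0 ∨ d = 1 := by lia
  · obtain ⟨f, hf, hf0⟩ := Submodule.exists_mem_ne_zero_of_ne_bot hj
    obtain ⟨m, hm⟩ := (MvPowerSeries.ne_zero_iff_exists_coeff_ne_zero f).1 hf0
    have := hf m hm
    rw [Subsingleton.elim m 0, map_zero, Nat.cast_zero] at this
    subst this
    exact nonempty_veronesePiece_zero_equiv
  -- `j.val` is the least exponent in the class `j`.
  · refine nonempty_veronesePiece_equiv_of_forall_dvd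
      (g := (MvPowerSeries.X 0 : MvPowerSeries (Fin 1) k) ^ j.val) ?_
      (pow_ne_zero _ fun h => by
        simpa using congrArg (MvPowerSeries.coeff (Finsupp.single 0 1)) h) fun f hf => ?_
    · intro m hm
      classical
      rw [MvPowerSeries.coeff_X_pow] at hm
      have hm' : m = Finsupp.single 0 j.val := by
        by_contra h
        exact hm (if_neg h)
      rw [hm', Finsupp.degree_single, ZMod.natCast_val, ZMod.cast_id]
    · rw [MvPowerSeries.X_pow_dvd_iff]
      intro m hm
      by_contra hne
      have h1 := congrArg ZMod.val (hf m hne)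
      have h2 : m.degree = m 0 := by simp [Finsupp.degree_eq_sum]
      rw [h2, ZMod.val_natCast, Nat.mod_eq_of_lt (hm.trans (ZMod.val_lt j))] at h1
      lia

end Free

/-! ### Torsion in tensor products of pieces. -/

section Tensor

/-- Both tensors become `r₁ • (u₀ ⊗ v₀)` after multiplication by `r₀`, and a reflexive module has no
torsion. -/
theorem TensorProduct.tmul_eq_tmul_of_smul_eq_smul {R M N : Type*} [CommRing R] [IsDomain R]
    [AddCommGroup M] [Module R M] [AddCommGroup N] [Module R N] [Module.IsReflexive R (M ⊗[R] N)]
    {r₀ r₁ : R} {u₀ u₁ : M} {v₀ v₁ : N} (hr₀ : r₀ ≠ 0) (hu : r₀ • u₁ = r₁ • u₀)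
    (hv : r₀ • v₁ = r₁ • v₀) : u₀ ⊗ₜ[R] v₁ = u₁ ⊗ₜ[R] v₀ := by
  rw [← sub_eq_zero]
  apply Module.IsReflexive.smul_eq_zero hr₀
  rw [smul_sub, ← tmul_smul, hv, tmul_smul, smul_tmul', smul_tmul', hu, sub_self]

variable {k : Type*} [Field k] {d n : ℕ}

/-- Used to tell two tensors apart: `f x * g y` is bilinear once `K` is an `R`-module through `χ`.
-/
theorem TensorProduct.mul_eq_mul_of_tmul_eq_tmul {R K M N : Type*} [CommRing R] [CommRing K]
    [AddCommGroup M] [Module R M] [AddCommGroup N] [Module R N] (χ : R →+* K) (f : M →+ K)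
    (g : N →+ K) (hf : ∀ r x, f (r • x) = χ r * f x) (hg : ∀ r x, g (r • x) = χ r * g x)
    {u₀ u₁ : M} {v₀ v₁ : N} (h : u₀ ⊗ₜ[R] v₁ = u₁ ⊗ₜ[R] v₀) : f u₀ * g v₁ = f u₁ * g v₀ := by
  let _ : Module R K := Module.compHom K χ
  let F : M →ₗ[R] N →ₗ[R] K := LinearMap.mk₂ R (fun x y => f x * g y)
    (fun x x' y => by rw [map_add, add_mul])
    (fun r x y => by rw [hf, mul_assoc]; rfl)
    (fun x y y' => by rw [map_add, mul_add])
    (fun r x y => by rw [hg, mul_left_comm]; rfl)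
  exact congrArg (lift F) h

theorem TensorProduct.not_isReflexive_of_smul_eq_smul {R K M N : Type*} [CommRing R] [IsDomain R]
    [CommRing K] [AddCommGroup M] [Module R M] [AddCommGroup N] [Module R N] {χ : R →+* K}
    {f : M →+ K} {g : N →+ K} (hf : ∀ r x, f (r • x) = χ r * f x)
    (hg : ∀ r x, g (r • x) = χ r * g x) {r₀ r₁ : R} {u₀ u₁ : M} {v₀ v₁ : N} (hr₀ : r₀ ≠ 0)
    (hu : r₀ • u₁ = r₁ • u₀) (hv : r₀ • v₁ = r₁ • v₀) (hne : f u₀ * g v₁ ≠ f u₁ * g v₀) :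
    ¬ Module.IsReflexive R (M ⊗[R] N) := fun _ =>
  hne (mul_eq_mul_of_tmul_eq_tmul χ f g hf hg (tmul_eq_tmul_of_smul_eq_smul hr₀ hu hv))

/-- The only monomial of `r` of degree below `n` is the constant one. Low coefficients are thus
linear over reduction to `k`. -/
theorem coeff_mul_of_degree_lt {r f : MvPowerSeries (Fin d) k} (hr : r ∈ veroneseSubring k d n)
    {m : Fin d →₀ ℕ} (hm : m.degree < n) :
    MvPowerSeries.coeff m (r * f) =
      MvPowerSeries.constantCoeff r * MvPowerSeries.coeff m f := by
  classical
  rw [MvPowerSeries.coeff_mul, Finset.sum_eq_single (0, m)]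
  · simp
  · intro p hp hne
    have hp := Finset.HasAntidiagonal.mem_antidiagonal.mp hp
    by_contra h
    have h1 := hr _ (left_ne_zero_of_mul h)
    have h2 : p.1.degree + p.2.degree = m.degree := by rw [← map_add, hp]
    have h3 : p.1 = 0 := by
      rw [← Finsupp.degree_eq_zero_iff]
      exact Nat.eq_zero_of_dvd_of_lt h1 (by lia)
    exact hne (Prod.ext h3 (by simpa [h3] using hp))
  · simp

/-- The monomial `X₀ ^ a * X₁ ^ b`. -/
noncomputable def twoVariableMonomial (k : Type*) [Field k] (d a b : ℕ) :
    MvPowerSeries (Fin (d + 2)) k :=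
  MvPowerSeries.monomial (Finsupp.single 0 a + Finsupp.single 1 b) 1

theorem twoVariableMonomial_mul (a b c e : ℕ) :
    twoVariableMonomial k d a b * twoVariableMonomial k d c e =
      twoVariableMonomial k d (a + c) (b + e) := by
  simp only [twoVariableMonomial, MvPowerSeries.monomial_mul_monomial, mul_one, Finsupp.single_add]
  rw [add_add_add_comm]

theorem coeff_twoVariableMonomial_same (a b : ℕ) :
    MvPowerSeries.coeff (Finsupp.single 0 a + Finsupp.single 1 b)
      (twoVariableMonomial k d a b) = 1 :=
  MvPowerSeries.coeff_monomial_same _ _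

theorem twoVariableMonomial_ne_zero (a b : ℕ) : twoVariableMonomial k d a b ≠ 0 := fun h => by
  have h1 := coeff_twoVariableMonomial_same (k := k) (d := d) a b
  rw [h, map_zero] at h1
  exact zero_ne_one h1

theorem twoVariableMonomial_mem {a b : ℕ} {l : ZMod n} (h : ((a + b : ℕ) : ZMod n) = l) :
    twoVariableMonomial k d a b ∈ veronesePiece k (d + 2) n l := by
  classical
  intro m hm
  rw [twoVariableMonomial, MvPowerSeries.coeff_monomial] at hm
  have hm' : m = Finsupp.single 0 a + Finsupp.single 1 b := by
    by_contra h
    exact hm (if_neg h)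
  rw [hm', map_add, Finsupp.degree_single, Finsupp.degree_single, h]

theorem coeff_twoVariableMonomial_of_ne {p : ℕ} :
    MvPowerSeries.coeff (Finsupp.single 0 (p + 1) + Finsupp.single 1 0)
      (twoVariableMonomial k d p 1) = 0 := by
  classical
  rw [twoVariableMonomial, MvPowerSeries.coeff_monomial, if_neg]
  intro h
  simpa using DFunLike.congr_fun h 1

/-- Extraction of a coefficient, transported along an isomorphism with a piece. -/
noncomputable def pieceCoeff {M : Type*} [AddCommGroup M] [Module (veroneseSubring k d n) M]
    {i : ZMod n} (e : M ≃ₗ[veroneseSubring k d n] veronesePiece k d n i) (m : Fin d →₀ ℕ) :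
    M →+ k where
  toFun x := MvPowerSeries.coeff m (e x : MvPowerSeries (Fin d) k)
  map_zero' := by rw [map_zero]; rfl
  map_add' x y := by rw [map_add]; rfl

theorem pieceCoeff_symm_apply {M : Type*} [AddCommGroup M] [Module (veroneseSubring k d n) M]
    {i : ZMod n} (e : M ≃ₗ[veroneseSubring k d n] veronesePiece k d n i) (m : Fin d →₀ ℕ)
    {f : MvPowerSeries (Fin d) k} (hf : f ∈ veronesePiece k d n i) :
    pieceCoeff e m (e.symm ⟨f, hf⟩) = MvPowerSeries.coeff m f := by
  change MvPowerSeries.coeff m (e (e.symm ⟨f, hf⟩) : MvPowerSeries (Fin d) k) = _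
  rw [e.apply_symm_apply]

theorem pieceCoeff_smul {M : Type*} [AddCommGroup M] [Module (veroneseSubring k d n) M]
    {i : ZMod n} (e : M ≃ₗ[veroneseSubring k d n] veronesePiece k d n i) {m : Fin d →₀ ℕ}
    (hm : m.degree < n) (r : veroneseSubring k d n) (x : M) :
    pieceCoeff e m (r • x) =
      (MvPowerSeries.constantCoeff.comp (veroneseSubring k d n).val.toRingHom) r *
        pieceCoeff e m x := by
  change MvPowerSeries.coeff m (e (r • x) : MvPowerSeries (Fin d) k) = _
  rw [map_smul]
  exact coeff_mul_of_degree_lt r.2 hm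

/-- The tensor product of two nontrivial pieces has torsion as soon as there are two variables. -/
theorem not_isReflexive_tensorProduct_of_equiv_veronesePiece [NeZero n] (hd : 2 ≤ d)
    {i j : ZMod n} (hi : i ≠ 0) (hj : j ≠ 0)
    {M : Type*} [AddCommGroup M] [Module (veroneseSubring k d n) M]
    {N : Type*} [AddCommGroup N] [Module (veroneseSubring k d n) N]
    (eM : M ≃ₗ[veroneseSubring k d n] veronesePiece k d n i)
    (eN : N ≃ₗ[veroneseSubring k d n] veronesePiece k d n j) :
    ¬ Module.IsReflexive (veroneseSubring k d n) (M ⊗[veroneseSubring k d n] N) := by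
  obtain ⟨d, rfl⟩ := Nat.exists_eq_add_of_le' hd
  have hpos {l : ZMod n} (hl : l ≠ 0) :
      ∃ p : ℕ, ((p + 1 : ℕ) : ZMod n) = l ∧ p + 1 < n := by
    refine ⟨l.val - 1, ?_⟩
    rw [Nat.sub_add_cancel (Nat.pos_of_ne_zero ((ZMod.val_ne_zero l).2 hl)), ZMod.natCast_val,
      ZMod.cast_id]
    exact ⟨rfl, ZMod.val_lt l⟩
  obtain ⟨p, hp, hpn⟩ := hpos hi
  obtain ⟨q, hq, hqn⟩ := hpos hj
  have hR {a b : ℕ} (h : a + b = n) : twoVariableMonomial k d a b ∈ veroneseSubring k (d + 2) n :=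
    mem_veronesePiece_zero.1 (twoVariableMonomial_mem (by rw [h, ZMod.natCast_self]))
  obtain ⟨c, hc⟩ : ∃ c, c + 1 = n := ⟨n - 1, Nat.succ_pred_eq_of_ne_zero (NeZero.ne n)⟩
  have hmul (s : ℕ) : twoVariableMonomial k d n 0 * twoVariableMonomial k d s 1 =
      twoVariableMonomial k d c 1 * twoVariableMonomial k d (s + 1) 0 := by
    rw [twoVariableMonomial_mul, twoVariableMonomial_mul, ← hc]
    congr 1
    lia
  have hm₀ : (Finsupp.single 0 (p + 1) + Finsupp.single 1 0 : Fin (d + 2) →₀ ℕ).degree < n := by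
    simpa only [map_add, Finsupp.degree_single, add_zero] using hpn
  have hm₁ : (Finsupp.single 0 q + Finsupp.single 1 1 : Fin (d + 2) →₀ ℕ).degree < n := by
    simpa only [map_add, Finsupp.degree_single] using hqn
  -- The scalars are `x^n` and `x^(n-1) y`. The functionals read the coefficient of `x^(p+1)` on the
  -- left and of `x^q y` on the right, giving `1` on `u₀`, `v₁` and `0` on `u₁`.
  refine TensorProduct.not_isReflexive_of_smul_eq_smul
    (χ := MvPowerSeries.constantCoeff.comp (veroneseSubring k (d + 2) n).val.toRingHom)
    (f := pieceCoeff eM _) (g := pieceCoeff eN _)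
    (pieceCoeff_smul eM hm₀) (pieceCoeff_smul eN hm₁)
    (r₀ := ⟨_, hR (add_zero n)⟩) (r₁ := ⟨_, hR hc⟩)
    (u₀ := eM.symm ⟨twoVariableMonomial k d (p + 1) 0, twoVariableMonomial_mem hp⟩)
    (u₁ := eM.symm ⟨twoVariableMonomial k d p 1, twoVariableMonomial_mem hp⟩)
    (v₀ := eN.symm ⟨twoVariableMonomial k d (q + 1) 0, twoVariableMonomial_mem hq⟩)
    (v₁ := eN.symm ⟨twoVariableMonomial k d q 1, twoVariableMonomial_mem hq⟩)
    (fun h => twoVariableMonomial_ne_zero n 0 (congrArg Subtype.val h)) ?_ ?_ ?_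
  · rw [← map_smul, ← map_smul]
    exact congrArg _ (Subtype.ext (hmul p))
  · rw [← map_smul, ← map_smul]
    exact congrArg _ (Subtype.ext (hmul q))
  · simp_rw [pieceCoeff_symm_apply]
    rw [coeff_twoVariableMonomial_same, coeff_twoVariableMonomial_same,
      coeff_twoVariableMonomial_of_ne, zero_mul, mul_one]
    exact one_ne_zero

end Tensor

theorem proposition3p15 {k : Type*} [Field k] (d n : ℕ) (hn : 1 < n)
    (I : Type*) [AddCommGroup I] [Module (veroneseSubring k d n) I]
    (J : Type*) [AddCommGroup J] [Module (veroneseSubring k d n) J]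
    (hI : RepresentsDivisorClass (veroneseSubring k d n) I)
    (hJ : RepresentsDivisorClass (veroneseSubring k d n) J)
    (hIJ : Module.IsReflexive (veroneseSubring k d n) (I ⊗[veroneseSubring k d n] J)) :
    Nonempty (I ≃ₗ[veroneseSubring k d n] veroneseSubring k d n) ∨
      Nonempty (J ≃ₗ[veroneseSubring k d n] veroneseSubring k d n) := by
  have : NeZero n := ⟨by lia⟩
  obtain ⟨i, ⟨eI⟩⟩ := hI.exists_equiv_veronesePiece
  obtain ⟨j, ⟨eJ⟩⟩ := hJ.exists_equiv_veronesePiece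
  rcases le_or_gt d 1 with hd | hd
  · obtain ⟨e⟩ := nonempty_veronesePiece_equiv_of_le_one hd (j := i) (k := k) fun hbot => by
      have : Subsingleton (veronesePiece k d n i) := by
        rw [hbot]
        infer_instance
      have := eI.toEquiv.subsingleton
      have h := hI.rank_eq_one
      rw [rank_subsingleton'] at h
      exact zero_ne_one h
    exact Or.inl ⟨eI.trans e⟩
  · by_cases hi : i = 0
    · subst hi
      obtain ⟨e⟩ := nonempty_veronesePiece_zero_equiv (k := k) (d := d) (n := n)
      exact Or.inl ⟨eI.trans e⟩
    by_cases hj : j = 0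
    · subst hj
      obtain ⟨e⟩ := nonempty_veronesePiece_zero_equiv (k := k) (d := d) (n := n)
      exact Or.inr ⟨eJ.trans e⟩
    · exact (not_isReflexive_tensorProduct_of_equiv_veronesePiece hd hi hj eI eJ hIJ).elim
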